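/- Let $m,n\ge 1$ be integers and let $0<\alpha_i,\beta_j,\lambda_{ij}\le 1$ ($1\le i\le m$, $1\le j\le n$) satisfy $\sum_{j=1}^n\lambda_{ij}=\alpha_i$, $\sum_{i=1}^m\lambda_{ij}=\beta_j$ and $\sum_{i=1}^m\sum_{j=1}^n\lambda_{ij}\le 1$. For $t>0$ put $$g(t)=\frac{\prod_{i=1}^m\Gamma(\alpha_it+1)\prod_{j=1}^n\Gamma(\beta_jt+1)}{\prod_{i=1}^m\prod_{j=1}^n\Gamma(\lambda_{ij}t+1)},$$ and for positive reals $y_1,\dots,y_r$ with sum $x$ write $\binom{x}{y_1,\dots,y_r}=\Gamma(x+1)/\prod_{l=1}^r\Gamma(y_l+1)$. Then $g$ is positive and strictly log-convex on $(0,\infty)$ (that is, $\log g$ is strictly convex there), and the following hold. (a) If $t_1,\dots,t_\nu>0$ and $\mu_1,\dots,\mu_\nu\in(0,1)$ with $\sum_{k=1}^\nu\mu_k=1$, then $g\big(\sum_{k=1}^\nu\mu_kt_k\big)\le\prod_{k=1}^\nu g(t_k)^{\mu_k}$, with equality if and only if all the $t_k$ are equal. (b) If $\nu\ge 2$ and $t_1,\dots,t_\nu>0$,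 then $\prod_{k=1}^\nu g(t_k)<g\big(\sum_{k=1}^\nu t_k\big)$. (c) If $t_1,t_2,t_3>0$ and $t_1\le t_3$, then $g(t_1+t_2)\,g(t_3)\le g(t_1)\,g(t_2+t_3)$, with equality if and only if $t_1=t_3$. Put $$P_i(t)=\binom{\alpha_it}{\lambda_{i1}t,\dots,\lambda_{in}t},\qquad Q_j(t)=\binom{\beta_jt}{\lambda_{1j}t,\dots,\lambda_{mj}t}.$$ Then $g(t)=\prod_{i=1}^m P_i(t)\prod_{j=1}^n Q_j(t)\prod_{i=1}^m\prod_{j=1}^n\Gamma(\lambda_{ij}t+1)$ for $t>0$, and moreover: (a') If $\nu\ge 1$, $t_1,\dots,t_\nu>0$ and $\bar t=\frac1\nu\sum_{k=1}^\nu t_k$, then $$\prod_{i=1}^m P_i(\bar t)\prod_{j=1}^n Q_j(\bar t)\prod_{i=1}^m\prod_{j=1}^n\binom{\lambda_{ij}\bar t}{\lambda_{ij}\frac{t_1}{\nu},\dots,\lambda_{ij}\frac{t_\nu}{\nu}}\le\prod_{k=1}^\nu\left[\prod_{i=1}^m P_i(t_k)\prod_{j=1}^n Q_j(t_k)\prod_{i=1}^m\prod_{j=1}^n\binom{\lambda_{ij}t_k}{\lambda_{ij}\frac{t_k}{\nu},\dots,\lambda_{ij}\frac{t_k}{\nu}}\right]^{1/\nu}$$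 (with $\nu$ lower entries in the last coefficient), with equality if and only if all the $t_k$ are equal. (b') If $\nu\ge 2$, $t_1,\dots,t_\nu>0$ and $s=\sum_{k=1}^\nu t_k$, then $$\prod_{k=1}^\nu\left[\prod_{i=1}^m P_i(t_k)\prod_{j=1}^n Q_j(t_k)\right]<\prod_{i=1}^m P_i(s)\prod_{j=1}^n Q_j(s)\prod_{i=1}^m\prod_{j=1}^n\binom{\lambda_{ij}s}{\lambda_{ij}t_1,\dots,\lambda_{ij}t_\nu}.$$ (c') If $t_1,t_2,t_3>0$ and $t_1\le t_3$, then $$\prod_{i=1}^m P_i(t_1+t_2)P_i(t_3)\prod_{j=1}^n Q_j(t_1+t_2)Q_j(t_3)\prod_{i=1}^m\prod_{j=1}^n\binom{\lambda_{ij}(t_1+t_2+t_3)}{\lambda_{ij}t_1,\ \lambda_{ij}(t_2+t_3)}$$ $$\le\prod_{i=1}^m P_i(t_1)P_i(t_2+t_3)\prod_{j=1}^n Q_j(t_1)Q_j(t_2+t_3)\prod_{i=1}^m\prod_{j=1}^n\binom{\lambda_{ij}(t_1+t_2+t_3)}{\lambda_{ij}(t_1+t_2),\ \lambda_{ij}t_3},$$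 with equality if and only if $t_1=t_3$. -/

import Mathlib

/-- The multinomial coefficient `x choose (y₁, y₂, …)` with real entries, where every factorial
`z!` is read as `Γ (z + 1)`; it is used when the `y`'s are positive with sum `x`. -/
noncomputable def gammaMultinomial {ι : Type*} [Fintype ι] (x : ℝ) (y : ι → ℝ) : ℝ :=
  Real.Gamma (x + 1) / ∏ i, Real.Gamma (y i + 1)

/-- The function `g (t) = ∏ᵢ Γ (αᵢ t + 1) ∏ⱼ Γ (βⱼ t + 1) / ∏ᵢ ∏ⱼ Γ (λᵢⱼ t + 1)`. -/
noncomputable def gammaRatio {m n : ℕ} (α : Fin m → ℝ) (β : Fin n → ℝ)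
    (lam : Fin m → Fin n → ℝ) (t : ℝ) : ℝ :=
  ((∏ i, Real.Gamma (α i * t + 1)) * ∏ j, Real.Gamma (β j * t + 1)) /
    ∏ i, ∏ j, Real.Gamma (lam i j * t + 1)

open Filter Topology

/-! Everything rests on the strict convexity of `log g` on the closed half-line `[0, ∞)`. Pairing
each `Γ (αᵢ t + 1)` with its row of the matrix writes `log g` as a sum of logarithms of multinomial
coefficients, which are convex in `t` (`convexOn_log_gamma_sub_sum`), plus the terms `log Γ (βⱼ t +
1)`, which are strictly convex (`strictConvexOn_log_gamma_add_one`).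

With `ψ' = (log Γ)''` and `A = ∑ aⱼ`, the multinomial term has second derivative `∑ aⱼ (A ψ' (A t +
1) - aⱼ ψ' (aⱼ t + 1))`, nonnegative because `x ψ' (x + 1)` is increasing. This is proved on
corrected Bohr-Mollerup approximants, and convexity passes to the limit.

Then (a) is Jensen, (b) is superadditivity from `g 0 = 1`, and (c) compares increments. The primed
statements are these divided by a common positive factor. -/

/-- The second derivative at `x` of the approximant
`logGammaSeq (x + 1) N + x ^ 2 / (2 * (N + 1))` of `log Γ (x + 1)`. -/
noncomputable def logGammaApproxDeriv₂ (N : ℕ) (x : ℝ) : ℝ :=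
  ∑ k ∈ Finset.range (N + 1), 1 / (x + 1 + k) ^ 2 + 1 / (N + 1)

/-- The approximant `logGammaSeq (x + 1) N + x ^ 2 / (2 * (N + 1))` of `log Γ (x + 1)`. -/
noncomputable def logGammaApprox (N : ℕ) (x : ℝ) : ℝ :=
  Real.BohrMollerup.logGammaSeq (x + 1) N + x ^ 2 / (2 * (N + 1))

/-! ### Approximants of `log Γ (x + 1)` and their second derivatives -/

lemma tendsto_logGammaApprox {x : ℝ} (hx : 0 ≤ x) :
    Tendsto (fun N => logGammaApprox N x) atTop (𝓝 (Real.log (Real.Gamma (x + 1)))) := by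
  have h1 := Real.BohrMollerup.tendsto_log_gamma (x := x + 1) (by linarith)
  have h2 : Tendsto (fun N : ℕ => (x ^ 2 / 2) * (1 / ((N : ℝ) + 1))) atTop (𝓝 ((x ^ 2 / 2) * 0)) :=
    tendsto_one_div_add_atTop_nhds_zero_nat.const_mul _
  rw [mul_zero] at h2
  have h3 := h1.add h2
  rw [add_zero] at h3
  refine h3.congr fun N => ?_
  have : (N : ℝ) + 1 ≠ 0 := by positivity
  unfold logGammaApprox
  field_simp

/-- The partial sums may be negative, but only by `O(1/N)`. Both sides vanish at `N = 0`, and the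
increments compare because `(x + 1 + N) ^ 2 ≥ N + 1 - x`. -/
lemma neg_one_div_le_sum_sub_div_cube {x : ℝ} (hx : 0 < x) (N : ℕ) :
    -(N / ((x + N) * (x + N + 1))) ≤
      ∑ k ∈ Finset.range N, ((k : ℝ) + 1 - x) / (x + 1 + k) ^ 3 := by
  induction N with
  | zero => simp
  | succ N ih =>
    rw [Finset.sum_range_succ]
    have hN : (0 : ℝ) ≤ N := N.cast_nonneg
    suffices h : -(((N : ℝ) + 1) / ((x + (N + 1)) * (x + (N + 1) + 1))) +
        N / ((x + N) * (x + N + 1)) ≤ ((N : ℝ) + 1 - x) / (x + 1 + N) ^ 3 by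
      push_cast
      linarith
    have h1 : 0 < x + N := by positivity
    have h2 : 0 < x + 1 + N := by positivity
    have h3 : 0 < x + N + 2 := by positivity
    have key : ((N : ℝ) + 1 - x) / (x + 1 + N) ^ 3 -
        (-(((N : ℝ) + 1) / ((x + (N + 1)) * (x + (N + 1) + 1))) + N / ((x + N) * (x + N + 1))) =
        ((x + 1 + N) ^ 2 - (N + 1 - x)) / ((x + 1 + N) ^ 3 * (x + N) * (x + N + 2)) := by
      have e1 : x + ((N : ℝ) + 1) = x + 1 + N := by ring
      have e2 : x + (N : ℝ) + 1 = x + 1 + N := by ring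
      have e3 : x + 1 + (N : ℝ) + 1 = x + N + 2 := by ring
      rw [e1, e2, e3]
      field_simp
      ring
    have : 0 ≤ ((x + 1 + N) ^ 2 - (N + 1 - x)) / ((x + 1 + N) ^ 3 * (x + N) * (x + N + 2)) := by
      apply div_nonneg _ (by positivity)
      nlinarith
    linarith

lemma monotoneOn_mul_logGammaApproxDeriv₂ (N : ℕ) :
    MonotoneOn (fun x => x * logGammaApproxDeriv₂ N x) (Set.Ioi 0) := by
  have hd : ∀ x ∈ Set.Ioi (0 : ℝ), HasDerivAt (fun x => x * logGammaApproxDeriv₂ N x)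
      (∑ k ∈ Finset.range (N + 1), ((k : ℝ) + 1 - x) / (x + 1 + k) ^ 3 + 1 / (N + 1)) x := by
    intro x hx
    rw [Set.mem_Ioi] at hx
    have h1 : ∀ k ∈ Finset.range (N + 1), HasDerivAt (fun x : ℝ => x / (x + 1 + k) ^ 2)
        (((k : ℝ) + 1 - x) / (x + 1 + k) ^ 3) x := by
      intro k _
      have h0 : x + 1 + k ≠ 0 := by positivity
      have := (hasDerivAt_id x).div ((((hasDerivAt_id x).add_const 1).add_const (k : ℝ)).pow 2)
        (pow_ne_zero 2 h0)
      refine this.congr_deriv ?_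
      simp
      field_simp
      ring
    have h2 := (HasDerivAt.fun_sum h1).add ((hasDerivAt_id x).mul_const (1 / ((N : ℝ) + 1)))
    rw [one_mul] at h2
    refine h2.congr_of_eventuallyEq (Eventually.of_forall fun y => ?_)
    simp [logGammaApproxDeriv₂, mul_add, Finset.mul_sum, div_eq_mul_inv]
  refine monotoneOn_of_hasDerivWithinAt_nonneg (convex_Ioi 0)
    (fun x hx => (hd x hx).continuousAt.continuousWithinAt)
    (fun x hx => (hd x (interior_subset hx)).hasDerivWithinAt) fun x hx => ?_
  have hx : 0 < x := interior_subset hx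
  have h := neg_one_div_le_sum_sub_div_cube hx (N + 1)
  push_cast at h
  -- The quadratic correction in the approximant exists for this: its contribution `1 / (N + 1)` to
  -- the derivative absorbs the truncation deficit.
  have h' : ((N : ℝ) + 1) / ((x + (N + 1)) * (x + (N + 1) + 1)) ≤ 1 / (N + 1) := by
    rw [div_le_div_iff₀ (by positivity) (by positivity)]
    have : (0 : ℝ) ≤ N := N.cast_nonneg
    nlinarith [mul_nonneg hx.le this]
  linarith

lemma exists_hasDerivAt_logGammaApprox (N : ℕ) : ∃ d : ℝ → ℝ, ∀ x, 0 ≤ x →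
    HasDerivAt (logGammaApprox N) (d x) x ∧ HasDerivAt d (logGammaApproxDeriv₂ N x) x := by
  refine ⟨fun x => Real.log N - ∑ k ∈ Finset.range (N + 1), (x + 1 + k)⁻¹ + x * (1 / (N + 1)),
    fun x hx => ⟨?_, ?_⟩⟩
  · have h1 : ∀ k ∈ Finset.range (N + 1), HasDerivAt (fun x : ℝ => Real.log (x + 1 + k))
        ((x + 1 + k)⁻¹) x := by
      intro k _
      have h0 : x + 1 + k ≠ 0 := by positivity
      simpa using (((hasDerivAt_id x).add_const 1).add_const (k : ℝ)).log h0
    have h2 := ((((((hasDerivAt_id x).add_const 1).mul_const (Real.log N)).add_const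
      (Real.log (N.factorial))).sub (HasDerivAt.fun_sum h1))).add
        (((hasDerivAt_id x).pow 2).div_const (2 * ((N : ℝ) + 1)))
    refine (h2.congr_of_eventuallyEq (Eventually.of_forall fun y => ?_)).congr_deriv ?_
    · simp [logGammaApprox, Real.BohrMollerup.logGammaSeq]
    · have : (N : ℝ) + 1 ≠ 0 := by positivity
      simp
      field_simp
  · have h1 : ∀ k ∈ Finset.range (N + 1), HasDerivAt (fun x : ℝ => (x + 1 + k)⁻¹)
        (-(1 / (x + 1 + k) ^ 2)) x := by
      intro k _
      have h0 : x + 1 + k ≠ 0 := by positivity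
      refine ((((hasDerivAt_id x).add_const 1).add_const (k : ℝ)).inv h0).congr_deriv ?_
      simp [neg_div]
    refine (((HasDerivAt.fun_sum h1).const_sub (Real.log N)).add
      ((hasDerivAt_id x).mul_const (1 / ((N : ℝ) + 1)))).congr_deriv ?_
    simp [logGammaApproxDeriv₂]

/-! ### Convexity of log-multinomials and of `log Γ` -/

lemma convexOn_of_tendsto {s : Set ℝ} {F : ℕ → ℝ → ℝ} {f : ℝ → ℝ} (hF : ∀ N, ConvexOn ℝ s (F N))
    (hs : Convex ℝ s) (h : ∀ x ∈ s, Tendsto (fun N => F N x) atTop (𝓝 (f x))) :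
    ConvexOn ℝ s f :=
  ⟨hs, fun x hx y hy a b ha hb hab =>
    le_of_tendsto_of_tendsto' (h _ (hs hx hy ha hb hab))
      (((h x hx).const_smul a).add ((h y hy).const_smul b))
      fun N => (hF N).2 hx hy ha hb hab⟩

/-- The logarithm of the multinomial coefficient `(∑ aⱼ) t choose (a₁ t, a₂ t, …)` is a convex
function of `t`. -/
lemma convexOn_log_gamma_sub_sum {ι : Type*} [Fintype ι] (a : ι → ℝ) (ha : ∀ j, 0 < a j) :
    ConvexOn ℝ (Set.Ici 0) fun t => Real.log (Real.Gamma ((∑ j, a j) * t + 1)) -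
      ∑ j, Real.log (Real.Gamma (a j * t + 1)) := by
  have hA : 0 ≤ ∑ j, a j := Finset.sum_nonneg fun j _ => (ha j).le
  refine convexOn_of_tendsto (F := fun N t => logGammaApprox N ((∑ j, a j) * t) -
      ∑ j, logGammaApprox N (a j * t)) (fun N => ?_) (convex_Ici 0) fun t ht =>
    (tendsto_logGammaApprox (mul_nonneg hA ht)).sub
      (tendsto_finsetSum _ fun j _ => tendsto_logGammaApprox (mul_nonneg (ha j).le ht))
  obtain ⟨d, hd⟩ := exists_hasDerivAt_logGammaApprox N
  have h1 : ∀ c : ℝ, 0 ≤ c → ∀ t : ℝ, 0 ≤ t →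
      HasDerivAt (fun t => logGammaApprox N (c * t)) (c * d (c * t)) t := fun c hc t ht => by
    have := (hd (c * t) (mul_nonneg hc ht)).1.comp t ((hasDerivAt_id t).const_mul c)
    refine this.congr_deriv ?_
    ring
  have h2 : ∀ c : ℝ, 0 ≤ c → ∀ t : ℝ, 0 ≤ t →
      HasDerivAt (fun t => c * d (c * t)) (c * (c * logGammaApproxDeriv₂ N (c * t))) t :=
      fun c hc t ht => by
    have := ((hd (c * t) (mul_nonneg hc ht)).2.comp t ((hasDerivAt_id t).const_mul c)).const_mul c
    refine this.congr_deriv ?_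
    ring
  have h1' := fun t (ht : 0 ≤ t) => (h1 _ hA t ht).fun_sub
    (HasDerivAt.fun_sum fun j (_ : j ∈ Finset.univ) => h1 _ (ha j).le t ht)
  have h2' := fun t (ht : 0 ≤ t) => (h2 _ hA t ht).fun_sub
    (HasDerivAt.fun_sum fun j (_ : j ∈ Finset.univ) => h2 _ (ha j).le t ht)
  refine convexOn_of_hasDerivWithinAt2_nonneg (convex_Ici 0)
    (fun t ht => (h1' t ht).continuousAt.continuousWithinAt)
    (fun t ht => (h1' t (interior_subset ht)).hasDerivWithinAt)
    (fun t ht => (h2' t (interior_subset ht)).hasDerivWithinAt) fun t ht => ?_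
  rw [interior_Ici] at ht
  have ht : 0 < t := ht
  -- One factor `∑ aⱼ` is distributed over `j`, so that each summand compares `x *
  -- logGammaApproxDeriv₂ N x` at `aⱼ t` and `(∑ aⱼ) t`, up to the factor `t`.
  rw [Finset.sum_mul, ← Finset.sum_sub_distrib]
  refine Finset.sum_nonneg fun j _ => ?_
  rw [← mul_sub]
  refine mul_nonneg (ha j).le (sub_nonneg.2 ?_)
  have hle : a j ≤ ∑ j, a j := Finset.single_le_sum (fun i _ => (ha i).le) (Finset.mem_univ j)
  have := monotoneOn_mul_logGammaApproxDeriv₂ N (Set.mem_Ioi.2 (mul_pos (ha j) ht))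
    (Set.mem_Ioi.2 (mul_pos ((ha j).trans_le hle) ht)) (mul_le_mul_of_nonneg_right hle ht.le)
  refine le_of_mul_le_mul_right ?_ ht
  simpa only [mul_right_comm _ _ t] using this

/-- By the functional equation `log Γ (z + 1) = log Γ (z + 2) - log (z + 1)`: a convex function
minus a strictly concave one. -/
lemma strictConvexOn_log_gamma_add_one :
    StrictConvexOn ℝ (Set.Ici 0) fun x => Real.log (Real.Gamma (x + 1)) := by
  refine ⟨convex_Ici 0, fun x hx y hy hxy a b ha hb hab => ?_⟩
  rw [Set.mem_Ici] at hx hy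
  have e : ∀ z : ℝ, 0 ≤ z →
      Real.log (Real.Gamma (z + 1)) = Real.log (Real.Gamma (z + 2)) - Real.log (z + 1) := by
    intro z hz
    have hz1 : 0 < z + 1 := by linarith
    rw [show z + 2 = z + 1 + 1 by ring, Real.Gamma_add_one hz1.ne',
      Real.log_mul hz1.ne' (Real.Gamma_pos_of_pos hz1).ne']
    ring
  have h1 := Real.convexOn_log_Gamma.2 (Set.mem_Ioi.2 (by linarith : 0 < x + 2))
    (Set.mem_Ioi.2 (by linarith : 0 < y + 2)) ha.le hb.le hab
  have h2 := strictConcaveOn_log_Ioi.2 (Set.mem_Ioi.2 (by linarith : 0 < x + 1))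
    (Set.mem_Ioi.2 (by linarith : 0 < y + 1)) (by simpa using hxy) ha hb hab
  simp only [smul_eq_mul, Function.comp_apply] at h1 h2 ⊢
  have e1 : a * (x + 2) + b * (y + 2) = a * x + b * y + 2 := by linear_combination 2 * hab
  have e2 : a * (x + 1) + b * (y + 1) = a * x + b * y + 1 := by linear_combination hab
  rw [e1] at h1
  rw [e2] at h2
  rw [e x hx, e y hy, e _ (by positivity)]
  linarith

lemma StrictConvexOn.comp_mul_left {f : ℝ → ℝ} (hf : StrictConvexOn ℝ (Set.Ici 0) f) {c : ℝ}
    (hc : 0 < c) : StrictConvexOn ℝ (Set.Ici 0) fun t => f (c * t) := by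
  refine ⟨convex_Ici 0, fun x hx y hy hxy a b ha hb hab => ?_⟩
  have := hf.2 (Set.mem_Ici.2 (mul_nonneg hc.le hx)) (Set.mem_Ici.2 (mul_nonneg hc.le hy))
    (fun h => hxy (mul_left_cancel₀ hc.ne' h)) ha hb hab
  simp only [smul_eq_mul] at this ⊢
  rwa [show c * (a * x + b * y) = a * (c * x) + b * (c * y) by ring]

lemma ConvexOn.fun_sum {ι : Type*} {s : Set ℝ} {u : Finset ι} {f : ι → ℝ → ℝ} (hs : Convex ℝ s)
    (hf : ∀ i ∈ u, ConvexOn ℝ s (f i)) : ConvexOn ℝ s fun x => ∑ i ∈ u, f i x := by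
  classical
  induction u using Finset.induction_on with
  | empty => simpa using convexOn_const (𝕜 := ℝ) (0 : ℝ) hs
  | insert i u hi ih =>
    simp only [Finset.sum_insert hi]
    exact (hf i (Finset.mem_insert_self i u)).add
      (ih fun j hj => hf j (Finset.mem_insert_of_mem hj))

lemma StrictConvexOn.fun_sum {ι : Type*} {s : Set ℝ} {u : Finset ι} {f : ι → ℝ → ℝ}
    (hu : u.Nonempty) (hf : ∀ i ∈ u, StrictConvexOn ℝ s (f i)) :
    StrictConvexOn ℝ s fun x => ∑ i ∈ u, f i x := by
  classical
  obtain ⟨i, hi⟩ := hu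
  simp only [← Finset.add_sum_erase u _ hi]
  exact (hf i hi).add_convexOn
    (ConvexOn.fun_sum (hf i hi).1 fun j hj => (hf j (Finset.mem_of_mem_erase hj)).convexOn)

lemma gamma_add_one_pos {x : ℝ} (hx : 0 ≤ x) : 0 < Real.Gamma (x + 1) :=
  Real.Gamma_pos_of_pos (by linarith)

/-! ### Inequalities for strictly convex functions -/

lemma StrictConvexOn.sum_lt_of_map_zero {f : ℝ → ℝ} (hf : StrictConvexOn ℝ (Set.Ici 0) f)
    (h0 : f 0 = 0) {ν : ℕ} (hν : 2 ≤ ν) {t : Fin ν → ℝ} (ht : ∀ k, 0 < t k) :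
    ∑ k, f (t k) < f (∑ k, t k) := by
  have : Nontrivial (Fin ν) := Fin.nontrivial_iff_two_le.2 hν
  have : NeZero ν := ⟨by omega⟩
  have hs : 0 < ∑ k, t k := Finset.sum_pos (fun k _ => ht k) Finset.univ_nonempty
  -- Each `t k` lies strictly between `0` and the sum, so `f` is there below its chord from the
  -- origin.
  have key : ∀ k, f (t k) < t k / (∑ k, t k) * f (∑ k, t k) := by
    intro k
    obtain ⟨l, hl⟩ := exists_ne k
    have hlt : t k < ∑ k, t k :=
      Finset.single_lt_sum hl (Finset.mem_univ k) (Finset.mem_univ l) (ht l) fun i _ _ => (ht i).le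
    have := hf.2 (Set.mem_Ici.2 hs.le) (Set.mem_Ici.2 le_rfl) hs.ne' (div_pos (ht k) hs)
      (sub_pos.2 ((div_lt_one hs).2 hlt)) (by ring)
    simp only [smul_eq_mul, mul_zero, add_zero, h0] at this
    rwa [div_mul_cancel₀ _ hs.ne'] at this
  calc ∑ k, f (t k) < ∑ k, t k / (∑ k, t k) * f (∑ k, t k) :=
        Finset.sum_lt_sum_of_nonempty Finset.univ_nonempty fun k _ => key k
    _ = f (∑ k, t k) := by rw [← Finset.sum_mul, ← Finset.sum_div, div_self hs.ne', one_mul]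

/-- Both `x + d` and `y` lie strictly inside `[x, y + d]`, with the two barycentric weights swapped;
adding the two chord bounds makes the weights sum to one. -/
lemma StrictConvexOn.add_lt_add_of_lt {f : ℝ → ℝ} {s : Set ℝ} (hf : StrictConvexOn ℝ s f)
    {x y d : ℝ} (hx : x ∈ s) (hy : y + d ∈ s) (hxy : x < y) (hd : 0 < d) :
    f (x + d) + f y < f x + f (d + y) := by
  rw [add_comm d y]
  have hL : 0 < y + d - x := by linarith
  have h1 := hf.2 hx hy (by linarith) (div_pos (sub_pos.2 hxy) hL) (div_pos hd hL)
    (by rw [← add_div]; exact (div_eq_one_iff_eq hL.ne').2 (by ring))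
  have h2 := hf.2 hx hy (by linarith) (div_pos hd hL) (div_pos (sub_pos.2 hxy) hL)
    (by rw [← add_div]; exact (div_eq_one_iff_eq hL.ne').2 (by ring))
  simp only [smul_eq_mul] at h1 h2
  have e1 : (y - x) / (y + d - x) * x + d / (y + d - x) * (y + d) = x + d := by
    field_simp; ring
  have e2 : d / (y + d - x) * x + (y - x) / (y + d - x) * (y + d) = y := by
    field_simp; ring
  have e3 : (y - x) / (y + d - x) + d / (y + d - x) = 1 := by
    rw [← add_div]; exact (div_eq_one_iff_eq hL.ne').2 (by ring)
  rw [e1] at h1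
  rw [e2] at h2
  calc f (x + d) + f y < _ := add_lt_add h1 h2
    _ = f x + f (y + d) := by linear_combination (f x + f (y + d)) * e3

/-! ### Properties of `g` and its multinomial form -/

section GammaRatio

variable {m n : ℕ} {α : Fin m → ℝ} {β : Fin n → ℝ} {lam : Fin m → Fin n → ℝ}

/-- The denominator `∏ᵢ ∏ⱼ Γ (λᵢⱼ t + 1)` of `gammaRatio`. -/
noncomputable def gammaMatrixProd (lam : Fin m → Fin n → ℝ) (t : ℝ) : ℝ :=
  ∏ i, ∏ j, Real.Gamma (lam i j * t + 1)

lemma gammaMatrixProd_pos (hlam : ∀ i j, 0 < lam i j) {t : ℝ} (ht : 0 ≤ t) :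
    0 < gammaMatrixProd lam t :=
  Finset.prod_pos fun i _ => Finset.prod_pos fun j _ =>
    gamma_add_one_pos (mul_nonneg (hlam i j).le ht)

lemma gammaRatio_pos (hα : ∀ i, 0 < α i) (hβ : ∀ j, 0 < β j) (hlam : ∀ i j, 0 < lam i j)
    {t : ℝ} (ht : 0 ≤ t) : 0 < gammaRatio α β lam t :=
  div_pos (mul_pos (Finset.prod_pos fun i _ => gamma_add_one_pos (mul_nonneg (hα i).le ht))
    (Finset.prod_pos fun j _ => gamma_add_one_pos (mul_nonneg (hβ j).le ht)))
    (gammaMatrixProd_pos hlam ht)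

lemma log_gammaRatio (hα : ∀ i, 0 < α i) (hβ : ∀ j, 0 < β j) (hlam : ∀ i j, 0 < lam i j)
    (hrow : ∀ i, ∑ j, lam i j = α i) {t : ℝ} (ht : 0 ≤ t) :
    Real.log (gammaRatio α β lam t) =
      ∑ i, (Real.log (Real.Gamma ((∑ j, lam i j) * t + 1)) -
        ∑ j, Real.log (Real.Gamma (lam i j * t + 1))) +
      ∑ j, Real.log (Real.Gamma (β j * t + 1)) := by
  have h1 : ∀ i, Real.Gamma (α i * t + 1) ≠ 0 := fun i =>
    (gamma_add_one_pos (mul_nonneg (hα i).le ht)).ne'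
  have h2 : ∀ j, Real.Gamma (β j * t + 1) ≠ 0 := fun j =>
    (gamma_add_one_pos (mul_nonneg (hβ j).le ht)).ne'
  have h3 : ∀ i j, Real.Gamma (lam i j * t + 1) ≠ 0 := fun i j =>
    (gamma_add_one_pos (mul_nonneg (hlam i j).le ht)).ne'
  have h3' : ∀ i, ∏ j, Real.Gamma (lam i j * t + 1) ≠ 0 := fun i =>
    Finset.prod_ne_zero_iff.2 fun j _ => h3 i j
  have h1' : ∏ i, Real.Gamma (α i * t + 1) ≠ 0 := Finset.prod_ne_zero_iff.2 fun i _ => h1 i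
  have h2' : ∏ j, Real.Gamma (β j * t + 1) ≠ 0 := Finset.prod_ne_zero_iff.2 fun j _ => h2 j
  rw [gammaRatio, Real.log_div (mul_ne_zero h1' h2')
    (Finset.prod_ne_zero_iff.2 fun i _ => h3' i), Real.log_mul h1' h2',
    Real.log_prod fun i _ => h1 i, Real.log_prod fun j _ => h2 j,
    Real.log_prod fun i _ => h3' i, Finset.sum_sub_distrib]
  simp only [hrow, Real.log_prod fun j _ => h3 _ j]
  ring

lemma strictConvexOn_log_gammaRatio (hn : 1 ≤ n) (hα : ∀ i, 0 < α i) (hβ : ∀ j, 0 < β j)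
    (hlam : ∀ i j, 0 < lam i j) (hrow : ∀ i, ∑ j, lam i j = α i) :
    StrictConvexOn ℝ (Set.Ici 0) fun t => Real.log (gammaRatio α β lam t) := by
  have : NeZero n := ⟨by omega⟩
  have h : StrictConvexOn ℝ (Set.Ici 0) fun t =>
      ∑ i, (Real.log (Real.Gamma ((∑ j, lam i j) * t + 1)) -
        ∑ j, Real.log (Real.Gamma (lam i j * t + 1))) +
      ∑ j, Real.log (Real.Gamma (β j * t + 1)) :=
    (ConvexOn.fun_sum (convex_Ici 0) fun i _ =>
      convexOn_log_gamma_sub_sum (lam i) (hlam i)).add_strictConvexOn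
      (StrictConvexOn.fun_sum Finset.univ_nonempty fun j _ =>
        strictConvexOn_log_gamma_add_one.comp_mul_left (hβ j))
  exact h.congr fun t ht => (log_gammaRatio hα hβ hlam hrow ht).symm

lemma gammaRatio_zero : gammaRatio α β lam 0 = 1 := by
  simp [gammaRatio]

lemma gammaRatio_jensen {ν : ℕ} {t μ : Fin ν → ℝ}
    (hpos : ∀ u : ℝ, 0 ≤ u → 0 < gammaRatio α β lam u)
    (hconv : StrictConvexOn ℝ (Set.Ici 0) fun t => Real.log (gammaRatio α β lam t))
    (ht : ∀ k, 0 < t k) (hμ : ∀ k, 0 < μ k) (hsum : ∑ k, μ k = 1) :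
    gammaRatio α β lam (∑ k, μ k * t k) ≤ ∏ k, gammaRatio α β lam (t k) ^ (μ k) ∧
      (gammaRatio α β lam (∑ k, μ k * t k) = ∏ k, gammaRatio α β lam (t k) ^ (μ k) ↔
        ∀ k l, t k = t l) := by
  have hg : 0 < gammaRatio α β lam (∑ k, μ k * t k) :=
    hpos _ (Finset.sum_nonneg fun k _ => mul_nonneg (hμ k).le (ht k).le)
  have hp : ∀ k, 0 < gammaRatio α β lam (t k) ^ (μ k) := fun k =>
    Real.rpow_pos_of_pos (hpos _ (ht k).le) _
  have hP : 0 < ∏ k, gammaRatio α β lam (t k) ^ (μ k) := Finset.prod_pos fun k _ => hp k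
  have hlog : Real.log (∏ k, gammaRatio α β lam (t k) ^ (μ k)) =
      ∑ k, μ k • Real.log (gammaRatio α β lam (t k)) := by
    rw [Real.log_prod fun k _ => (hp k).ne']
    exact Finset.sum_congr rfl fun k _ => Real.log_rpow (hpos _ (ht k).le) _
  constructor
  · rw [← Real.log_le_log_iff hg hP, hlog]
    exact hconv.convexOn.map_sum_le (fun k _ => (hμ k).le) hsum fun k _ => (ht k).le
  · rw [← Real.log_injOn_pos.eq_iff hg hP, hlog]
    have := hconv.map_sum_eq_iff_of_pos (t := Finset.univ) (w := μ) (p := t)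
      (fun k _ => hμ k) hsum fun k _ => (ht k).le
    simpa using this

lemma prod_gammaRatio_lt {ν : ℕ} {t : Fin ν → ℝ} (hν : 2 ≤ ν)
    (hpos : ∀ u : ℝ, 0 ≤ u → 0 < gammaRatio α β lam u)
    (hconv : StrictConvexOn ℝ (Set.Ici 0) fun t => Real.log (gammaRatio α β lam t))
    (ht : ∀ k, 0 < t k) :
    ∏ k, gammaRatio α β lam (t k) < gammaRatio α β lam (∑ k, t k) := by
  rw [← Real.log_lt_log_iff (Finset.prod_pos fun k _ => hpos _ (ht k).le)
    (hpos _ (Finset.sum_nonneg fun k _ => (ht k).le)),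
    Real.log_prod fun k _ => (hpos _ (ht k).le).ne']
  exact hconv.sum_lt_of_map_zero (by simp [gammaRatio_zero]) hν ht

lemma gammaRatio_mul_lt {t₁ t₂ t₃ : ℝ}
    (hpos : ∀ u : ℝ, 0 ≤ u → 0 < gammaRatio α β lam u)
    (hconv : StrictConvexOn ℝ (Set.Ici 0) fun t => Real.log (gammaRatio α β lam t))
    (h₁ : 0 < t₁) (h₂ : 0 < t₂) (h : t₁ < t₃) :
    gammaRatio α β lam (t₁ + t₂) * gammaRatio α β lam t₃ <
      gammaRatio α β lam t₁ * gammaRatio α β lam (t₂ + t₃) := by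
  have p1 := hpos t₁ h₁.le
  have p2 := hpos t₃ (by linarith)
  have p3 := hpos (t₁ + t₂) (by linarith)
  have p4 := hpos (t₂ + t₃) (by linarith)
  rw [← Real.log_lt_log_iff (mul_pos p3 p2) (mul_pos p1 p4), Real.log_mul p3.ne' p2.ne',
    Real.log_mul p1.ne' p4.ne']
  exact hconv.add_lt_add_of_lt (Set.mem_Ici.2 h₁.le) (Set.mem_Ici.2 (by linarith)) h h₂

lemma prod_gammaMultinomial_eq_div (t : ℝ) :
    (∏ i, gammaMultinomial (α i * t) (fun j => lam i j * t)) *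
      (∏ j, gammaMultinomial (β j * t) (fun i => lam i j * t)) =
      gammaRatio α β lam t / gammaMatrixProd lam t := by
  simp only [gammaMultinomial, gammaRatio, gammaMatrixProd, Finset.prod_div_distrib]
  rw [Finset.prod_comm (f := fun j i => Real.Gamma (lam i j * t + 1)), div_mul_div_comm, div_div]

/-- The numerator here cancels the denominator of `prod_gammaMultinomial_eq_div`, which turns (a')
and (b') into (a) and (b). -/
lemma prod_prod_gammaMultinomial {ι : Type*} [Fintype ι] (x : ℝ) (y : ι → ℝ) :
    ∏ i, ∏ j, gammaMultinomial (lam i j * x) (fun l => lam i j * y l) =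
      gammaMatrixProd lam x / ∏ l, gammaMatrixProd lam (y l) := by
  simp only [gammaMultinomial, gammaMatrixProd, Finset.prod_div_distrib]
  congr 1
  rw [Finset.prod_comm]
  simp only [Finset.prod_comm (s := Finset.univ (α := Fin m)) (t := Finset.univ (α := ι))]
  rw [Finset.prod_comm]
  refine Finset.prod_congr rfl fun l _ => Finset.prod_comm

end GammaRatio

theorem corollary1 (m n : ℕ) (hm : 1 ≤ m) (hn : 1 ≤ n)
    (α : Fin m → ℝ) (β : Fin n → ℝ) (lam : Fin m → Fin n → ℝ)
    (hα : ∀ i, 0 < α i ∧ α i ≤ 1) (hβ : ∀ j, 0 < β j ∧ β j ≤ 1)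
    (hlam : ∀ i j, 0 < lam i j ∧ lam i j ≤ 1)
    (hrow : ∀ i, ∑ j, lam i j = α i) (hcol : ∀ j, ∑ i, lam i j = β j)
    (htotal : ∑ i, ∑ j, lam i j ≤ 1) :
    -- `g` is positive and strictly log-convex on `(0, ∞)`
    ((∀ t : ℝ, 0 < t → 0 < gammaRatio α β lam t) ∧
      StrictConvexOn ℝ (Set.Ioi 0) (fun t => Real.log (gammaRatio α β lam t))) ∧
    -- (a)
    (∀ (ν : ℕ) (t μ : Fin ν → ℝ), (∀ k, 0 < t k) → (∀ k, 0 < μ k ∧ μ k < 1) → ∑ k, μ k = 1 →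
      gammaRatio α β lam (∑ k, μ k * t k) ≤ ∏ k, gammaRatio α β lam (t k) ^ (μ k) ∧
      (gammaRatio α β lam (∑ k, μ k * t k) = ∏ k, gammaRatio α β lam (t k) ^ (μ k) ↔
        ∀ k l, t k = t l)) ∧
    -- (b)
    (∀ (ν : ℕ) (t : Fin ν → ℝ), 2 ≤ ν → (∀ k, 0 < t k) →
      ∏ k, gammaRatio α β lam (t k) < gammaRatio α β lam (∑ k, t k)) ∧
    -- (c)
    (∀ t₁ t₂ t₃ : ℝ, 0 < t₁ → 0 < t₂ → 0 < t₃ → t₁ ≤ t₃ →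
      gammaRatio α β lam (t₁ + t₂) * gammaRatio α β lam t₃ ≤
        gammaRatio α β lam t₁ * gammaRatio α β lam (t₂ + t₃) ∧
      (gammaRatio α β lam (t₁ + t₂) * gammaRatio α β lam t₃ =
        gammaRatio α β lam t₁ * gammaRatio α β lam (t₂ + t₃) ↔ t₁ = t₃)) ∧
    -- the form of `g` in terms of multinomial coefficients
    (∀ t : ℝ, 0 < t → gammaRatio α β lam t =
      (∏ i, gammaMultinomial (α i * t) (fun j => lam i j * t)) *
      (∏ j, gammaMultinomial (β j * t) (fun i => lam i j * t)) *
      ∏ i, ∏ j, Real.Gamma (lam i j * t + 1)) ∧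
    -- (a')
    (∀ (ν : ℕ) (t : Fin ν → ℝ) (tbar : ℝ), 1 ≤ ν → (∀ k, 0 < t k) →
      tbar = (1 / (ν : ℝ)) * ∑ k, t k →
      ((∏ i, gammaMultinomial (α i * tbar) (fun j => lam i j * tbar)) *
        (∏ j, gammaMultinomial (β j * tbar) (fun i => lam i j * tbar)) *
        (∏ i, ∏ j, gammaMultinomial (lam i j * tbar)
          (fun l : Fin ν => lam i j * (t l / (ν : ℝ)))) ≤
      ∏ k, ((∏ i, gammaMultinomial (α i * t k) (fun j => lam i j * t k)) *
        (∏ j, gammaMultinomial (β j * t k) (fun i => lam i j * t k)) *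
        (∏ i, ∏ j, gammaMultinomial (lam i j * t k)
          (fun _ : Fin ν => lam i j * (t k / (ν : ℝ))))) ^ (1 / (ν : ℝ))) ∧
      ((∏ i, gammaMultinomial (α i * tbar) (fun j => lam i j * tbar)) *
        (∏ j, gammaMultinomial (β j * tbar) (fun i => lam i j * tbar)) *
        (∏ i, ∏ j, gammaMultinomial (lam i j * tbar)
          (fun l : Fin ν => lam i j * (t l / (ν : ℝ)))) =
      ∏ k, ((∏ i, gammaMultinomial (α i * t k) (fun j => lam i j * t k)) *
        (∏ j, gammaMultinomial (β j * t k) (fun i => lam i j * t k)) *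
        (∏ i, ∏ j, gammaMultinomial (lam i j * t k)
          (fun _ : Fin ν => lam i j * (t k / (ν : ℝ))))) ^ (1 / (ν : ℝ)) ↔
        ∀ k l, t k = t l)) ∧
    -- (b')
    (∀ (ν : ℕ) (t : Fin ν → ℝ) (s : ℝ), 2 ≤ ν → (∀ k, 0 < t k) → s = ∑ k, t k →
      ∏ k, ((∏ i, gammaMultinomial (α i * t k) (fun j => lam i j * t k)) *
        (∏ j, gammaMultinomial (β j * t k) (fun i => lam i j * t k))) <
      (∏ i, gammaMultinomial (α i * s) (fun j => lam i j * s)) *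
        (∏ j, gammaMultinomial (β j * s) (fun i => lam i j * s)) *
        (∏ i, ∏ j, gammaMultinomial (lam i j * s) (fun k => lam i j * t k))) ∧
    -- (c')
    (∀ t₁ t₂ t₃ : ℝ, 0 < t₁ → 0 < t₂ → 0 < t₃ → t₁ ≤ t₃ →
      ((∏ i, (gammaMultinomial (α i * (t₁ + t₂)) (fun j => lam i j * (t₁ + t₂)) *
          gammaMultinomial (α i * t₃) (fun j => lam i j * t₃))) *
        (∏ j, (gammaMultinomial (β j * (t₁ + t₂)) (fun i => lam i j * (t₁ + t₂)) *
          gammaMultinomial (β j * t₃) (fun i => lam i j * t₃))) *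
        (∏ i, ∏ j, gammaMultinomial (lam i j * (t₁ + t₂ + t₃))
          ![lam i j * t₁, lam i j * (t₂ + t₃)]) ≤
      (∏ i, (gammaMultinomial (α i * t₁) (fun j => lam i j * t₁) *
          gammaMultinomial (α i * (t₂ + t₃)) (fun j => lam i j * (t₂ + t₃)))) *
        (∏ j, (gammaMultinomial (β j * t₁) (fun i => lam i j * t₁) *
          gammaMultinomial (β j * (t₂ + t₃)) (fun i => lam i j * (t₂ + t₃)))) *
        (∏ i, ∏ j, gammaMultinomial (lam i j * (t₁ + t₂ + t₃))
          ![lam i j * (t₁ + t₂), lam i j * t₃])) ∧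
      ((∏ i, (gammaMultinomial (α i * (t₁ + t₂)) (fun j => lam i j * (t₁ + t₂)) *
          gammaMultinomial (α i * t₃) (fun j => lam i j * t₃))) *
        (∏ j, (gammaMultinomial (β j * (t₁ + t₂)) (fun i => lam i j * (t₁ + t₂)) *
          gammaMultinomial (β j * t₃) (fun i => lam i j * t₃))) *
        (∏ i, ∏ j, gammaMultinomial (lam i j * (t₁ + t₂ + t₃))
          ![lam i j * t₁, lam i j * (t₂ + t₃)]) =
      (∏ i, (gammaMultinomial (α i * t₁) (fun j => lam i j * t₁) *
          gammaMultinomial (α i * (t₂ + t₃)) (fun j => lam i j * (t₂ + t₃)))) *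
        (∏ j, (gammaMultinomial (β j * t₁) (fun i => lam i j * t₁) *
          gammaMultinomial (β j * (t₂ + t₃)) (fun i => lam i j * (t₂ + t₃)))) *
        (∏ i, ∏ j, gammaMultinomial (lam i j * (t₁ + t₂ + t₃))
          ![lam i j * (t₁ + t₂), lam i j * t₃]) ↔ t₁ = t₃)) := by
  have hα' := fun i => (hα i).1
  have hβ' := fun j => (hβ j).1
  have hlam' := fun i j => (hlam i j).1
  have hconv := strictConvexOn_log_gammaRatio hn hα' hβ' hlam' hrow
  have hpos : ∀ u : ℝ, 0 ≤ u → 0 < gammaRatio α β lam u := fun u hu =>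
    gammaRatio_pos hα' hβ' hlam' hu
  have hL : ∀ u : ℝ, 0 ≤ u → 0 < gammaMatrixProd lam u := fun u hu => gammaMatrixProd_pos hlam' hu
  have hPQ : ∀ u : ℝ, (∏ i, gammaMultinomial (α i * u) (fun j => lam i j * u)) *
      (∏ j, gammaMultinomial (β j * u) (fun i => lam i j * u)) =
      gammaRatio α β lam u / gammaMatrixProd lam u :=
    prod_gammaMultinomial_eq_div
  have hc : ∀ t₁ t₂ t₃ : ℝ, 0 < t₁ → 0 < t₂ → 0 < t₃ → t₁ ≤ t₃ →
      gammaRatio α β lam (t₁ + t₂) * gammaRatio α β lam t₃ ≤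
        gammaRatio α β lam t₁ * gammaRatio α β lam (t₂ + t₃) ∧
      (gammaRatio α β lam (t₁ + t₂) * gammaRatio α β lam t₃ =
        gammaRatio α β lam t₁ * gammaRatio α β lam (t₂ + t₃) ↔ t₁ = t₃) := by
    intro t₁ t₂ t₃ h₁ h₂ h₃ h
    rcases h.eq_or_lt with rfl | hlt
    · have e : gammaRatio α β lam (t₁ + t₂) * gammaRatio α β lam t₁ =
        gammaRatio α β lam t₁ * gammaRatio α β lam (t₂ + t₁) := by rw [add_comm t₁, mul_comm]
      exact ⟨e.le, by simp [e]⟩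
    · have := gammaRatio_mul_lt hpos hconv h₁ h₂ hlt
      exact ⟨this.le, by simp [this.ne, hlt.ne]⟩
  refine ⟨⟨fun t ht => hpos t ht.le, hconv.subset Set.Ioi_subset_Ici_self (convex_Ioi 0)⟩,
    fun ν t μ ht hμ hsum => gammaRatio_jensen hpos hconv ht (fun k => (hμ k).1) hsum,
    fun ν t hν ht => prod_gammaRatio_lt hν hpos hconv ht, hc, fun t ht => ?_, ?_, ?_, ?_⟩
  · rw [hPQ t]
    exact (div_mul_cancel₀ _ (hL t ht.le).ne').symm
  · intro ν t tbar hν ht htbar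
    have hν0 : (0 : ℝ) < ν := by exact_mod_cast hν
    have htb : tbar = ∑ k, 1 / (ν : ℝ) * t k := by rw [htbar, Finset.mul_sum]
    have htb0 : 0 ≤ tbar := htb ▸ Finset.sum_nonneg fun k _ => mul_nonneg (by positivity) (ht k).le
    have hM : 0 < ∏ l, gammaMatrixProd lam (t l / ν) :=
      Finset.prod_pos fun l _ => hL _ (div_nonneg (ht l).le hν0.le)
    have hJ := gammaRatio_jensen (μ := fun _ => 1 / (ν : ℝ)) hpos hconv ht
      (fun _ => by positivity) (by simp [hν0.ne'])
    rw [← htb] at hJ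
    -- The `ν` equal lower entries give a `ν`-th power, undone by the exponent `1 / ν`; both sides
    -- of (a') then share the denominator `∏ l, gammaMatrixProd lam (t l / ν)`.
    have hR : ∀ k, ((∏ i, gammaMultinomial (α i * t k) (fun j => lam i j * t k)) *
        (∏ j, gammaMultinomial (β j * t k) (fun i => lam i j * t k)) *
        (∏ i, ∏ j, gammaMultinomial (lam i j * t k)
          (fun _ : Fin ν => lam i j * (t k / (ν : ℝ))))) ^ (1 / (ν : ℝ)) =
        gammaRatio α β lam (t k) ^ (1 / (ν : ℝ)) / gammaMatrixProd lam (t k / ν) := by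
      intro k
      have hk := hL _ (div_nonneg (ht k).le hν0.le)
      rw [hPQ _, prod_prod_gammaMultinomial (t k) fun _ : Fin ν => t k / (ν : ℝ),
        div_mul_div_cancel₀ (hL _ (ht k).le).ne', Finset.prod_const, Finset.card_univ,
        Fintype.card_fin, Real.div_rpow (hpos _ (ht k).le).le (pow_nonneg hk.le _), one_div,
        Real.pow_rpow_inv_natCast hk.le (by omega)]
    rw [Finset.prod_congr rfl fun k _ => hR k, hPQ tbar,
      prod_prod_gammaMultinomial tbar fun l => t l / (ν : ℝ),
      div_mul_div_cancel₀ (hL _ htb0).ne', Finset.prod_div_distrib,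
      div_le_div_iff_of_pos_right hM, div_left_inj' hM.ne']
    exact hJ
  · intro ν t s hν ht hs
    have hs0 : 0 ≤ s := hs ▸ Finset.sum_nonneg fun k _ => (ht k).le
    have h := prod_gammaRatio_lt hν hpos hconv ht
    rw [Finset.prod_congr rfl fun k _ => hPQ _, hPQ s,
      prod_prod_gammaMultinomial s t, div_mul_div_cancel₀ (hL _ hs0).ne', Finset.prod_div_distrib,
      div_lt_div_iff_of_pos_right (Finset.prod_pos fun k _ => hL _ (ht k).le), hs]
    exact h
  · intro t₁ t₂ t₃ h₁ h₂ h₃ h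
    have hv : ∀ (c x y : ℝ), ![c * x, c * y] = fun l => c * ![x, y] l := by
      intro c x y
      ext l
      fin_cases l <;> rfl
    have hD : ∀ x y z : ℝ,
        (∏ i, (gammaMultinomial (α i * x) (fun j => lam i j * x) *
          gammaMultinomial (α i * y) (fun j => lam i j * y))) *
        (∏ j, (gammaMultinomial (β j * x) (fun i => lam i j * x) *
          gammaMultinomial (β j * y) (fun i => lam i j * y))) * z =
        gammaRatio α β lam x * gammaRatio α β lam y *
          (z / (gammaMatrixProd lam x * gammaMatrixProd lam y)) := by
      intro x y z
      rw [Finset.prod_mul_distrib, Finset.prod_mul_distrib, mul_mul_mul_comm, hPQ x, hPQ y]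
      ring
    have q1 := hL t₁ h₁.le
    have q2 := hL t₃ h₃.le
    have q3 := hL (t₁ + t₂) (by linarith)
    have q4 := hL (t₂ + t₃) (by linarith)
    have q5 := hL (t₁ + t₂ + t₃) (by linarith)
    simp only [hv, prod_prod_gammaMultinomial, Fin.prod_univ_two, Matrix.cons_val_zero,
      Matrix.cons_val_one]
    rw [hD, hD, div_div, div_div,
      mul_comm (gammaMatrixProd lam (t₁ + t₂) * _) (gammaMatrixProd lam t₁ * _)]
    -- The factor common to both sides of (c'): each side's `P`, `Q` product supplies two of the
    -- denominators and its last coefficient the other two.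
    have hK : 0 < gammaMatrixProd lam (t₁ + t₂ + t₃) /
        (gammaMatrixProd lam t₁ * gammaMatrixProd lam (t₂ + t₃) *
          (gammaMatrixProd lam (t₁ + t₂) * gammaMatrixProd lam t₃)) := by positivity
    rw [mul_le_mul_iff_left₀ hK, mul_left_inj' hK.ne']
    exact hc t₁ t₂ t₃ h₁ h₂ h₃ h
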